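/- Let $n\ge 1$ and let $B_n$ be the hyperoctahedral group: the set of bijections $w$ of $\{-n,\dots,-1,0,1,\dots,n\}$ with $w(-i)=-w(i)$ for all $i$. For $w\in B_n$ let $\mathrm{des}_B(w)=|\{0\le i\le n-1 : w(i)>w(i+1)\}|$, and let $\mathrm{sgn}_B(w)=(-1)^{|J|}\,\mathrm{sgn}(u)$, where $J=\{1\le j\le n: w(j)<0\}$ and $u\in S_n$ is the permutation $u(j)=|w(j)|$. Put $$B_n^{\pm}(t)=\sum_{w\in B_n,\ \mathrm{sgn}_B(w)=\pm1} t^{\mathrm{des}_B(w)}.$$ For a fixed choice of sign, let $W_n^{\pm}$ be a random variable for which $\mathbb P(W_n^{\pm}=k)$ is the coefficient of $t^k$ in $B_n^{\pm}(t)$ divided by the sum $B_n^{\pm}(1)$ of all coefficients. **Theorem 4.5 (Limiting distribution, type B).** For each of the two signs, the distribution of the coefficients of $B_n^{\pm}(t)$ is asymptotically normal as $n\to\infty$: the standardized variable $(W_n^{\pm}-\mathbb E W_n^{\pm})/\sqrt{\operatorname{Var} W_n^{\pm}}$ converges in distribution to the standard normal law, i.e. for every real $x$, $$\mathbb P\!\left(\frac{W_n^{\pm}-\mathbb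 E W_n^{\pm}}{\sqrt{\operatorname{Var} W_n^{\pm}}}\le x\right)\longrightarrow \frac1{\sqrt{2\pi}}\int_{-\infty}^x e^{-y^2/2}\,dy .$$ Moreover $\mathbb E W_n^{\pm}=n/2$ for all $n\ge 2$, and $\operatorname{Var} W_n^{\pm}=(n+1)/12$ for all $n\ge 3$. -/

import Mathlib

/-- The interval `[±n] = {-n, …, -1, 0, 1, …, n}`. -/
abbrev PMInterval (n : ℕ) : Type := {i : ℤ // i ∈ Finset.Icc (-(n : ℤ)) n}

/-- The negation map `i ↦ -i` of `[±n]`. -/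
def PMInterval.neg {n : ℕ} (i : PMInterval n) : PMInterval n :=
  ⟨-i.1, by have h := Finset.mem_Icc.1 i.2; exact Finset.mem_Icc.2 ⟨by omega, by omega⟩⟩

/-- The point `i ∈ {0, 1, …, n}`, regarded as an element of `[±n]`. -/
def PMInterval.ofFin {n : ℕ} (i : Fin (n + 1)) : PMInterval n :=
  ⟨(i : ℕ), by have h := i.2; exact Finset.mem_Icc.2 ⟨by omega, by omega⟩⟩

/-- The hyperoctahedral group `B_n` (as a finite set): the bijections `w : [±n] → [±n]` with
`w(-i) = -w(i)` for all `i`. -/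
abbrev SignedPerm (n : ℕ) : Type :=
  {w : Equiv.Perm (PMInterval n) // ∀ i, w i.neg = (w i).neg}

namespace SignedPerm

variable {n : ℕ}

/-- The integer `w(i)`, for `0 ≤ i ≤ n`. -/
def entry (w : SignedPerm n) (i : Fin (n + 1)) : ℤ := (w.1 (PMInterval.ofFin i)).1

/-- Type B descent number: the number of `0 ≤ i ≤ n - 1` such that `w(i) > w(i+1)`. -/
def desB (w : SignedPerm n) : ℕ :=
  (Finset.univ.filter fun i : Fin n => w.entry i.castSucc > w.entry i.succ).card

/-- The set `J` of those `j ∈ [n]` with `w(j) < 0`. The element `j : Fin n` stands for the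
position `j + 1 ∈ [n]`. -/
def negSet (w : SignedPerm n) : Finset (Fin n) :=
  Finset.univ.filter fun j => w.entry j.succ < 0

theorem abs_entry_le (w : SignedPerm n) (i : Fin (n + 1)) : |w.entry i| ≤ n := by
  have h := Finset.mem_Icc.1 (w.1 (PMInterval.ofFin i)).2
  exact abs_le.2 h

theorem eq_of_abs_entry_eq (w : SignedPerm n) {i j : Fin (n + 1)}
    (h : |w.entry i| = |w.entry j|) : i = j := by
  rcases abs_eq_abs.1 h with h | h
  · have h1 := congrArg Subtype.val (w.1.injective (Subtype.ext h))
    simp only [PMInterval.ofFin] at h1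
    exact Fin.ext (by omega)
  · have h0 : w.1 (PMInterval.ofFin i) = w.1 (PMInterval.ofFin j).neg := by
      rw [w.2]; exact Subtype.ext h
    have h1 := congrArg Subtype.val (w.1.injective h0)
    simp only [PMInterval.ofFin, PMInterval.neg] at h1
    exact Fin.ext (by omega)

theorem one_le_abs_entry_succ (w : SignedPerm n) (j : Fin n) : 1 ≤ |w.entry j.succ| := by
  have h00 : w.entry 0 = 0 := by
    have hz : (PMInterval.ofFin (0 : Fin (n + 1))).neg = PMInterval.ofFin 0 :=
      Subtype.ext (by simp [PMInterval.neg, PMInterval.ofFin])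
    have h := congrArg Subtype.val (w.2 (PMInterval.ofFin 0))
    rw [hz] at h
    simp only [PMInterval.neg] at h
    unfold entry
    omega
  by_contra hlt
  have h0 : |w.entry j.succ| = |w.entry 0| := by
    have := abs_nonneg (w.entry j.succ)
    rw [h00, abs_zero]
    omega
  exact Fin.succ_ne_zero j (w.eq_of_abs_entry_eq h0)

/-- The underlying unsigned permutation `u ∈ S_n` of `w`, given by `u(j) = |w(j)|`
(with `[n]` shifted to `Fin n = {0, …, n - 1}`). Thus `w = u^J` with `J = negSet w`. -/
noncomputable def unsigned (w : SignedPerm n) : Equiv.Perm (Fin n) :=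
  Equiv.ofBijective
    (fun j => ⟨(w.entry j.succ).natAbs - 1, by
      have h1 := w.abs_entry_le j.succ
      have h2 := w.one_le_abs_entry_succ j
      rw [Int.abs_eq_natAbs] at h1 h2
      omega⟩)
    (Finite.injective_iff_bijective.1 (by
      intro i j hij
      have h := congrArg Fin.val hij
      simp only at h
      have h1 := w.one_le_abs_entry_succ i
      have h2 := w.one_le_abs_entry_succ j
      rw [Int.abs_eq_natAbs] at h1 h2
      exact Fin.succ_injective n (w.eq_of_abs_entry_eq (by
        rw [Int.abs_eq_natAbs, Int.abs_eq_natAbs]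
        omega))))

/-- The sign of `w = u^J ∈ B_n`: `sgn_B(w) = (-1)^{|J|} sgn(u)`. -/
noncomputable def sgnB (w : SignedPerm n) : ℤˣ :=
  (-1) ^ w.negSet.card * Equiv.Perm.sign w.unsigned

end SignedPerm

/-- The type B `±`-Eulerian polynomial: `eulerianPolyB 1 n = B_n^+(t)` and
`eulerianPolyB (-1) n = B_n^-(t)`, the sum of `t^{des_B(w)}` over the `w ∈ B_n` of sign `ε`. -/
noncomputable def eulerianPolyB (ε : ℤˣ) (n : ℕ) : Polynomial ℕ :=
  ∑ w : SignedPerm n with w.sgnB = ε, Polynomial.X ^ w.desB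

/-- The distribution of the coefficients of `p`: the law of a random variable `W` such that
`P(W = k) = (coefficient of t^k in p) / (sum of all coefficients of p)`. -/
noncomputable def coeffDist (p : Polynomial ℕ) : MeasureTheory.Measure ℝ :=
  ((p.eval 1 : ℕ) : ENNReal)⁻¹ •
    ∑ k ∈ p.support, ((p.coeff k : ℕ) : ENNReal) • MeasureTheory.Measure.dirac (k : ℝ)

/-- The mean of a distribution on the real line. -/
noncomputable def distMean (μ : MeasureTheory.Measure ℝ) : ℝ := ∫ y, y ∂μ

/-- The variance of a distribution on the real line. -/
noncomputable def distVariance (μ : MeasureTheory.Measure ℝ) : ℝ :=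
  ProbabilityTheory.variance (fun y : ℝ => y) μ

/-- Asymptotic normality: if `W_n` has law `μ n`, then the standardized variables
`(W_n - E W_n) / √(Var W_n)` converge in distribution to the standard normal law, that is,
their distribution functions converge pointwise to that of `N(0, 1)`. -/
def AsymptoticallyNormal (μ : ℕ → MeasureTheory.Measure ℝ) : Prop :=
  ∀ x : ℝ, Filter.Tendsto
    (fun n => (μ n).real {y | (y - distMean (μ n)) / Real.sqrt (distVariance (μ n)) ≤ x})
    Filter.atTop (nhds ((ProbabilityTheory.gaussianReal 0 1).real (Set.Iic x)))

/-!
# Asymptotic normality of the type B `±`-Eulerian polynomials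

Write `des` for `des_B`. There are two ingredients.

**The signs hardly matter.** A signed permutation is a permutation `u` with a sign for each
position. If `u ≠ 1`, it has a peak that is not in the last position, and flipping the sign there
changes `sgn_B` but not `des`. Hence in a sum `∑ w, sgn_B(w) f(des w)` only the `2 ^ n` terms with
`u = 1` survive, and there `des` counts the negative signs (`sum_sgnB_smul`; in terms of generating
functions, `∑ w, sgn_B(w) t ^ des(w) = (1 - t) ^ n`). Such a sum is at most `2 ^ n * sup |f|`, while
`B_n` has `2 ^ n * n!` elements, and it vanishes if `f(k) = k ^ m` with `m < n`
(`sum_sgnB_smul_desB_pow`). So restricting to either sign does not affect the limit law, nor the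
moments of order less than `n` (`integral_coeffDist`).

**Descents are turns around a circle.** Let `V = (V_1, …, V_n)` be uniformly distributed on the
torus `(ℝ / ℤ) ^ n`, represented in `(-1/2, 1/2]`. By symmetry under `B_n`, the number of descents
of `0, V_1, …, V_n` is distributed as `des` on `B_n` (`sum_desB_eq_integral`). Let `U_i` in `(0, 1]`
represent `V_i - V_{i-1}`, with `V_0 = 0`. Going from `V_{i-1}` to `V_i` in the positive direction
crosses the cut of the circle exactly if there is a descent, so `des = ∑ U_i - V_n`
(`torusDes_eq`). The map `V ↦ U` is a surjective endomorphism of the torus, hence preserves its Haar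
measure, and the `U_i` are independent and uniform (`measurePreserving_torusSteps`). The term `V_n`
is bounded, so the central limit theorem for `∑ U_i` gives that for `des`
(`tendsto_integral_cexp_torusDes`). For `n ≥ 2`, `V_n` is uncorrelated with each `U_i`, so the
variance is `n / 12 + 1 / 12` (`integral_torusDes_sub_sq`).
-/

open MeasureTheory ProbabilityTheory Filter Topology

/-! ### Signed permutations as permutations with signs -/

/-- The entry of the sequence `x` before position `i`, where the sequence is preceded by a `0`. -/
def prevEntry {α : Type*} [Zero α] {n : ℕ} (x : Fin n → α) (i : Fin n) : α :=
  if i.1 = 0 then 0 else x ⟨i.1 - 1, by omega⟩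

/-- The number of descents of the sequence `0, x 0, …, x (n - 1)`. -/
def seqDes {α : Type*} [Zero α] [LinearOrder α] {n : ℕ} (x : Fin n → α) : ℕ :=
  (Finset.univ.filter fun i : Fin n => x i < prevEntry x i).card

/-- The number of descents depends only on the relative order of the entries and of `0`. -/
theorem seqDes_congr {α β : Type*} [Zero α] [LinearOrder α] [Zero β] [LinearOrder β] {n : ℕ}
    {x : Fin n → α} {y : Fin n → β} (h : ∀ i j, x i < x j ↔ y i < y j)
    (h0 : ∀ i, x i < 0 ↔ y i < 0) : seqDes x = seqDes y := by
  unfold seqDes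
  congr 1
  ext i
  simp only [Finset.mem_filter, Finset.mem_univ, true_and]
  unfold prevEntry
  split_ifs
  · exact h0 i
  · exact h _ _

/-- The window of the signed permutation with underlying permutation `u` and signs `s`: the
integer in position `j` is `s j * (u j + 1)`. -/
def signedWindow {n : ℕ} (u : Equiv.Perm (Fin n)) (s : Fin n → ℤˣ) (j : Fin n) : ℤ :=
  (s j : ℤ) * ((u j : ℕ) + 1)

namespace SignedPerm

variable {n : ℕ}

/-- The sign of the entry `w(j + 1)`. -/
def entrySign (w : SignedPerm n) (j : Fin n) : ℤˣ := if w.entry j.succ < 0 then -1 else 1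

theorem entry_zero (w : SignedPerm n) : w.entry 0 = 0 := by
  have hz : (PMInterval.ofFin (0 : Fin (n + 1))).neg = PMInterval.ofFin 0 :=
    Subtype.ext (by simp [PMInterval.neg, PMInterval.ofFin])
  have h := congrArg Subtype.val (w.2 (PMInterval.ofFin 0))
  rw [hz] at h
  simp only [PMInterval.neg] at h
  unfold entry
  omega

theorem entry_succ (w : SignedPerm n) (j : Fin n) :
    w.entry j.succ = signedWindow w.unsigned w.entrySign j := by
  have h2 := w.one_le_abs_entry_succ j
  have hu : ((w.unsigned j : ℕ) : ℤ) + 1 = |w.entry j.succ| := by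
    have : (w.unsigned j : ℕ) = (w.entry j.succ).natAbs - 1 := rfl
    rw [this, Int.abs_eq_natAbs]
    rw [Int.abs_eq_natAbs] at h2
    omega
  rw [signedWindow, hu, entrySign]
  split_ifs with h
  · rw [abs_of_neg h]; simp
  · rw [abs_of_nonneg (not_lt.1 h)]; simp

theorem desB_eq_seqDes (w : SignedPerm n) :
    w.desB = seqDes (signedWindow w.unsigned w.entrySign) := by
  unfold desB seqDes
  congr 1
  ext i
  simp only [Finset.mem_filter, Finset.mem_univ, true_and]
  rw [← entry_succ, gt_iff_lt, prevEntry]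
  have : w.entry i.castSucc =
      if i.1 = 0 then 0 else signedWindow w.unsigned w.entrySign ⟨i.1 - 1, by omega⟩ := by
    split_ifs with h
    · rw [← w.entry_zero]; congr 1; exact Fin.ext h
    · rw [← entry_succ]; congr 1; apply Fin.ext; simp; omega
  rw [this]

theorem sgnB_eq (w : SignedPerm n) :
    w.sgnB = (∏ j, w.entrySign j) * Equiv.Perm.sign w.unsigned := by
  unfold sgnB negSet entrySign
  rw [Finset.prod_ite]
  simp

theorem ext_entry {w w' : SignedPerm n} (h : ∀ i, w.entry i = w'.entry i) : w = w' := by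
  apply Subtype.ext
  have key : ∀ i : PMInterval n, 0 ≤ i.1 → w.1 i = w'.1 i := by
    intro i hi
    have h2 := Finset.mem_Icc.1 i.2
    have : i = PMInterval.ofFin (⟨i.1.toNat, by omega⟩ : Fin (n + 1)) :=
      Subtype.ext (by simp [PMInterval.ofFin, hi])
    rw [this]
    exact Subtype.ext (h _)
  ext1 i
  rcases le_total 0 i.1 with hi | hi
  · exact key i hi
  · have hn : i = i.neg.neg := Subtype.ext (by simp [PMInterval.neg])
    rw [hn, w.2, w'.2, key i.neg (by simp [PMInterval.neg, hi])]

theorem exists_unsigned_entrySign (u : Equiv.Perm (Fin n)) (s : Fin n → ℤˣ) :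
    ∃ w : SignedPerm n, w.unsigned = u ∧ w.entrySign = s := by
  -- the odd extension of the window to all integers, with value `0` outside `[±n] \ {0}`
  let g : ℤ → ℤ := fun i => if h : 1 ≤ i.natAbs ∧ i.natAbs ≤ n then
    i.sign * signedWindow u s ⟨i.natAbs - 1, by omega⟩ else 0
  have habs : ∀ j, |signedWindow u s j| = (u j : ℕ) + 1 := by
    intro j
    rw [signedWindow, abs_mul]
    have : |((s j : ℤˣ) : ℤ)| = 1 := by rcases Int.units_eq_one_or (s j) with h | h <;> simp [h]
    rw [this, one_mul, abs_of_nonneg (by positivity)]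
  have gneg : ∀ i, g (-i) = -g i := by
    intro i
    simp only [g, Int.natAbs_neg, Int.sign_neg]
    split_ifs <;> ring
  have gabs : ∀ i (h : 1 ≤ i.natAbs ∧ i.natAbs ≤ n),
      |g i| = (u ⟨i.natAbs - 1, by omega⟩ : ℕ) + 1 := by
    intro i h
    simp only [g, dif_pos h, abs_mul, habs]
    have : |i.sign| = 1 := by
      rcases lt_trichotomy i 0 with h' | h' | h'
      · simp [Int.sign_eq_neg_one_of_neg h']
      · simp [h'] at h
      · simp [Int.sign_eq_one_of_pos h']
    rw [this, one_mul]
  have gzero : ∀ i, ¬ (1 ≤ i.natAbs ∧ i.natAbs ≤ n) → g i = 0 := fun i h => by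
    simp only [g, dif_neg h]
  let G : PMInterval n → PMInterval n := fun i => ⟨g i.1, by
    rw [Finset.mem_Icc, ← abs_le]
    by_cases h : 1 ≤ i.1.natAbs ∧ i.1.natAbs ≤ n
    · rw [gabs _ h]
      have := (u ⟨i.1.natAbs - 1, by omega⟩).2
      omega
    · rw [gzero _ h]; simp⟩
  have Ginj : Function.Injective G := by
    intro i j hij
    have hij : g i.1 = g j.1 := congrArg Subtype.val hij
    have hi := Finset.mem_Icc.1 i.2
    have hj := Finset.mem_Icc.1 j.2
    apply Subtype.ext
    by_cases h : 1 ≤ i.1.natAbs ∧ i.1.natAbs ≤ n <;> by_cases h' : 1 ≤ j.1.natAbs ∧ j.1.natAbs ≤ n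
    · have e := congrArg abs hij
      rw [gabs _ h, gabs _ h'] at e
      have e' : (⟨i.1.natAbs - 1, by omega⟩ : Fin n) = ⟨j.1.natAbs - 1, by omega⟩ :=
        u.injective (Fin.ext (by omega))
      have e2 := congrArg Fin.val e'
      simp only at e2
      have e3 : i.1.natAbs = j.1.natAbs := by omega
      rcases Int.natAbs_eq_natAbs_iff.1 e3 with e4 | e4
      · exact e4
      · exfalso
        rw [e4, gneg] at hij
        have : |g j.1| = 0 := by rw [abs_eq_zero]; omega
        rw [gabs _ h'] at this
        omega
    · have e := congrArg abs hij
      rw [gabs _ h, gzero _ h'] at e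
      simp at e; omega
    · have e := congrArg abs hij
      rw [gabs _ h', gzero _ h] at e
      simp at e; omega
    · omega
  let w : SignedPerm n := ⟨Equiv.ofBijective G (Finite.injective_iff_bijective.1 Ginj), fun i =>
    Subtype.ext (gneg i.1)⟩
  have hw : ∀ j : Fin n, w.entry j.succ = signedWindow u s j := by
    intro j
    change g ((j.succ : Fin (n + 1)) : ℕ) = _
    have hj := j.2
    have h : 1 ≤ (((j.succ : Fin (n + 1)) : ℕ) : ℤ).natAbs ∧
      (((j.succ : Fin (n + 1)) : ℕ) : ℤ).natAbs ≤ n := by simp; omega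
    simp only [g, dif_pos h]
    rw [Int.sign_eq_one_of_pos (by simp), one_mul]
    congr 1
  refine ⟨w, ?_, ?_⟩
  · ext j
    change (w.entry j.succ).natAbs - 1 = _
    have := habs j
    rw [hw]
    rw [Int.abs_eq_natAbs] at this
    omega
  · ext j
    rw [entrySign, hw, signedWindow]
    rcases Int.units_eq_one_or (s j) with h | h <;> rw [h]
    · rw [if_neg]; simp; omega
    · rw [if_pos]; simp; omega

/-- A signed permutation is the same thing as a permutation together with a choice of signs. -/
noncomputable def equivProd (n : ℕ) :
    SignedPerm n ≃ Equiv.Perm (Fin n) × (Fin n → ℤˣ) :=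
  Equiv.ofBijective (fun w => (w.unsigned, w.entrySign)) ⟨fun w w' h => by
    have h1 : w.unsigned = w'.unsigned := congrArg Prod.fst h
    have h2 : w.entrySign = w'.entrySign := congrArg Prod.snd h
    apply ext_entry
    intro i
    refine Fin.cases ?_ (fun j => ?_) i
    · rw [entry_zero, entry_zero]
    · rw [entry_succ, entry_succ, h1, h2], fun p => by
    obtain ⟨w, h1, h2⟩ := exists_unsigned_entrySign p.1 p.2
    exact ⟨w, Prod.ext h1 h2⟩⟩

theorem card_eq (n : ℕ) : Fintype.card (SignedPerm n) = n.factorial * 2 ^ n := by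
  rw [Fintype.card_congr (equivProd n), Fintype.card_prod, Fintype.card_perm]
  simp

theorem sum_eq_sum_prod {M : Type*} [AddCommMonoid M] (f : ℤˣ → ℕ → M) :
    ∑ w : SignedPerm n, f w.sgnB w.desB =
      ∑ u : Equiv.Perm (Fin n), ∑ s : Fin n → ℤˣ,
        f ((∏ j, s j) * Equiv.Perm.sign u) (seqDes (signedWindow u s)) := by
  rw [← Fintype.sum_prod_type']
  exact Fintype.sum_equiv (equivProd n) _ _ fun w => by
    rw [sgnB_eq, desB_eq_seqDes]; rfl

end SignedPerm

/-! ### The signed distribution of descents -/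

/-- Changing the sign in position `p` of a sign vector. -/
def flipSign {n : ℕ} (p : Fin n) (s : Fin n → ℤˣ) : Fin n → ℤˣ := Function.update s p (-s p)

theorem flipSign_self {n : ℕ} (p : Fin n) (s : Fin n → ℤˣ) : flipSign p s p = -s p := by
  simp [flipSign]

theorem flipSign_of_ne {n : ℕ} {p i : Fin n} (h : i ≠ p) (s : Fin n → ℤˣ) :
    flipSign p s i = s i := by
  simp [flipSign, h]

/-- The sum over all sign vectors, weighted by the product of the signs, of a function that does
not change when the sign in position `p` is flipped. -/
theorem sum_prod_sign_smul_eq_zero {E : Type*} [AddCommGroup E] {n : ℕ}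
    (p : Fin n) (g : (Fin n → ℤˣ) → E) (hg : ∀ s, g (flipSign p s) = g s) :
    ∑ s : Fin n → ℤˣ, ((∏ j, s j : ℤˣ) : ℤ) • g s = 0 := by
  refine Finset.sum_involution (fun s _ => flipSign p s) ?_ ?_ (by simp) ?_
  · intro s _
    have : ∏ j, flipSign p s j = -∏ j, s j := by
      rw [flipSign, Finset.prod_update_of_mem (Finset.mem_univ p), neg_mul,
        ← Finset.mul_prod_erase Finset.univ s (Finset.mem_univ p), Finset.sdiff_singleton_eq_erase]
    rw [hg, this]
    simp
  · intro s _ _ h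
    have := congrFun h p
    rw [flipSign_self] at this
    rcases Int.units_eq_one_or (s p) with h | h <;> rw [h] at this <;> revert this <;> decide
  · intro s _
    ext i
    simp [flipSign]

theorem signedWindow_lt_iff_of_lt {n : ℕ} {u : Equiv.Perm (Fin n)} (s : Fin n → ℤˣ) {i p : Fin n}
    (h : u i < u p) :
    (signedWindow u s i < signedWindow u s p ↔ s p = 1) ∧
      (signedWindow u s p < signedWindow u s i ↔ s p = -1) := by
  have h' : (u i : ℕ) < u p := h
  unfold signedWindow
  rcases Int.units_eq_one_or (s p) with hp | hp <;>
    rcases Int.units_eq_one_or (s i) with hi | hi <;>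
    rw [hp, hi] <;> simp <;> omega

theorem signedWindow_neg_iff {n : ℕ} (u : Equiv.Perm (Fin n)) (s : Fin n → ℤˣ) (p : Fin n) :
    signedWindow u s p < 0 ↔ s p = -1 := by
  unfold signedWindow
  rcases Int.units_eq_one_or (s p) with hp | hp <;> rw [hp] <;> simp <;> omega

theorem signedWindow_flipSign_of_ne {n : ℕ} (u : Equiv.Perm (Fin n)) {p i : Fin n} (h : i ≠ p)
    (s : Fin n → ℤˣ) : signedWindow u (flipSign p s) i = signedWindow u s i := by
  simp [signedWindow, flipSign_of_ne h]

/-- Flipping the sign at an interior peak `p` of `u` moves a descent from one side of `p` to the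
other, so the number of descents does not change. -/
theorem seqDes_signedWindow_flipSign {n : ℕ} (u : Equiv.Perm (Fin n)) (s : Fin n → ℤˣ)
    (p q : Fin n) (hq : q.1 = p.1 + 1) (hup : ∀ i : Fin n, i.1 + 1 = p.1 → u i < u p)
    (huq : u q < u p) :
    seqDes (signedWindow u (flipSign p s)) = seqDes (signedWindow u s) := by
  have hpq : p ≠ q := fun h => by rw [h] at hq; omega
  have atP : ∀ s : Fin n → ℤˣ,
      signedWindow u s p < prevEntry (signedWindow u s) p ↔ s p = -1 := by
    intro s
    unfold prevEntry
    split_ifs with h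
    · exact signedWindow_neg_iff u s p
    · exact (signedWindow_lt_iff_of_lt s (hup _ (by simp; omega))).2
  have atQ : ∀ s : Fin n → ℤˣ,
      signedWindow u s q < prevEntry (signedWindow u s) q ↔ s p = 1 := by
    intro s
    have : prevEntry (signedWindow u s) q = signedWindow u s p := by
      unfold prevEntry
      rw [if_neg (by omega)]
      congr 1
      exact Fin.ext (by simp; omega)
    rw [this]
    exact (signedWindow_lt_iff_of_lt s huq).1
  unfold seqDes
  refine Finset.card_equiv (Equiv.swap p q) fun i => ?_
  simp only [Finset.mem_filter, Finset.mem_univ, true_and]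
  -- only the descents ending at `p` and at `q` are affected, and they are exchanged
  have hneg : ∀ a : ℤˣ, (-a = -1 ↔ a = 1) ∧ (-a = 1 ↔ a = -1) := by decide
  by_cases hip : i = p
  · rw [hip, Equiv.swap_apply_left, atP, atQ, flipSign_self, (hneg _).1]
  by_cases hiq : i = q
  · rw [hiq, Equiv.swap_apply_right, atP, atQ, flipSign_self, (hneg _).2]
  rw [Equiv.swap_apply_of_ne_of_ne hip hiq, signedWindow_flipSign_of_ne u hip]
  have : prevEntry (signedWindow u (flipSign p s)) i = prevEntry (signedWindow u s) i := by
    unfold prevEntry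
    split_ifs with h
    · rfl
    · refine signedWindow_flipSign_of_ne u (fun h' => hiq (Fin.ext ?_)) s
      have := congrArg Fin.val h'
      simp only at this
      omega
  rw [this]

/-- A nonidentity permutation has an interior peak: the position of the largest value that is not
a fixed point. -/
theorem exists_interior_peak {n : ℕ} {u : Equiv.Perm (Fin n)} (hu : u ≠ 1) :
    ∃ p q : Fin n, q.1 = p.1 + 1 ∧ (∀ i : Fin n, i.1 + 1 = p.1 → u i < u p) ∧ u q < u p := by
  have hne : u.support.Nonempty := by
    rw [Finset.nonempty_iff_ne_empty, Ne, Equiv.Perm.support_eq_empty_iff]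
    exact hu
  let m := u.support.max' hne
  have hm : u m ≠ m := Equiv.Perm.mem_support.1 (u.support.max'_mem hne)
  have hmax : ∀ i, m < i → u i = i := fun i hi => by
    by_contra h
    exact absurd (u.support.le_max' i (Equiv.Perm.mem_support.2 h)) (not_le.2 hi)
  obtain ⟨p, hp⟩ := u.surjective m
  have hpm : p < m := by
    rcases lt_trichotomy p m with h | h | h
    · exact h
    · rw [h] at hp; exact absurd hp hm
    · have := hmax p h
      rw [hp] at this
      exact absurd this h.ne
  have key : ∀ i, i ≤ m → i ≠ p → u i < u p := by
    intro i hi hip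
    rw [hp]
    refine lt_of_le_of_ne (not_lt.1 fun h => ?_) (fun h => hip (u.injective (h.trans hp.symm)))
    have := u.injective (hmax _ h)
    rw [this] at h
    exact absurd h (not_lt.2 hi)
  have hpm' : p.1 < m.1 := hpm
  refine ⟨p, ⟨p.1 + 1, by omega⟩, rfl, fun i hi => key i ?_ ?_, key _ ?_ ?_⟩
  · rw [Fin.le_def]; omega
  · intro h; rw [h] at hi; omega
  · rw [Fin.le_def]; simp; omega
  · intro h; have := congrArg Fin.val h; simp at this

theorem seqDes_signedWindow_one {n : ℕ} (s : Fin n → ℤˣ) :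
    seqDes (signedWindow 1 s) = (Finset.univ.filter fun j => s j = -1).card := by
  unfold seqDes
  congr 1
  ext i
  simp only [Finset.mem_filter, Finset.mem_univ, true_and]
  unfold prevEntry
  split_ifs with h
  · exact signedWindow_neg_iff 1 s i
  · refine (signedWindow_lt_iff_of_lt s ?_).2
    simp [Fin.lt_def]; omega

/-- The signed distribution of `des_B` on `B_n` is that of the number of entries `-1` of a sign
vector, weighted by the product of its entries (whose generating function is `(1 - t) ^ n`). -/
theorem sum_sgnB_smul {E : Type*} [AddCommGroup E] (n : ℕ) (f : ℕ → E) :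
    ∑ w : SignedPerm n, (w.sgnB : ℤ) • f w.desB =
      ∑ s : Fin n → ℤˣ, ((∏ j, s j : ℤˣ) : ℤ) • f (Finset.univ.filter fun j => s j = -1).card := by
  -- for `u ≠ 1` the terms cancel in pairs, by flipping the sign at an interior peak of `u`
  rw [SignedPerm.sum_eq_sum_prod (fun e k => (e : ℤ) • f k), Finset.sum_eq_single 1]
  · simp [seqDes_signedWindow_one]
  · intro u _ hu
    obtain ⟨p, q, hq, h1, h2⟩ := exists_interior_peak hu
    have := sum_prod_sign_smul_eq_zero p (fun s => f (seqDes (signedWindow u s)))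
      fun s => by rw [seqDes_signedWindow_flipSign u s p q hq h1 h2]
    simp only [Units.val_mul, mul_comm _ ((Equiv.Perm.sign u : ℤˣ) : ℤ), mul_smul]
    rw [← Finset.smul_sum, this, smul_zero]
  · simp

/-- A signed sum over `B_n` has at most `2 ^ n` uncancelled terms, out of `2 ^ n * n!`. -/
theorem norm_sum_sgnB_smul_le {E : Type*} [NormedAddCommGroup E] (n : ℕ) (f : ℕ → E) {C : ℝ}
    (hf : ∀ k, ‖f k‖ ≤ C) : ‖∑ w : SignedPerm n, (w.sgnB : ℤ) • f w.desB‖ ≤ 2 ^ n * C := by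
  rw [sum_sgnB_smul]
  refine (norm_sum_le_of_le _ (f := fun s : Fin n → ℤˣ => _) (n := fun _ => C) fun s _ => ?_).trans ?_
  · rcases Int.units_eq_one_or (∏ j, s j) with h | h <;> rw [h] <;> simpa using hf _
  · simp

/-- The signed moments of `des_B` of order `m < n` vanish: the `m`-th power of the number of signs
`-1` is a sum of terms that involve at most `m` positions, so each has a position it ignores. -/
theorem sum_sgnB_smul_desB_pow {n m : ℕ} (h : m < n) :
    ∑ w : SignedPerm n, (w.sgnB : ℤ) • ((w.desB : ℝ) ^ m) = 0 := by
  rw [sum_sgnB_smul n (fun k => (k : ℝ) ^ m)]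
  have hc : ∀ s : Fin n → ℤˣ, ((Finset.univ.filter fun j => s j = -1).card : ℝ) ^ m =
      ∑ c : Fin m → Fin n, ∏ i, if s (c i) = -1 then (1 : ℝ) else 0 := by
    intro s
    rw [Finset.card_filter]
    push_cast
    rw [Fintype.sum_pow]
  simp only [hc, Finset.smul_sum]
  rw [Finset.sum_comm]
  refine Finset.sum_eq_zero fun c _ => ?_
  obtain ⟨p, hp⟩ : ∃ p, p ∉ Set.range c := by
    by_contra! hcon
    have := Fintype.card_le_of_surjective c hcon
    simp at this
    omega
  refine sum_prod_sign_smul_eq_zero p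
    (fun s => ∏ i, if s (c i) = -1 then (1 : ℝ) else 0) fun s => ?_
  refine Finset.prod_congr rfl fun i _ => ?_
  rw [flipSign_of_ne]
  rintro rfl
  exact hp ⟨i, rfl⟩

/-! ### Representatives on the circle, and generic points of the torus -/

/-- The representative in `(-1/2, 1/2]` of a point of the circle `ℝ / ℤ`. -/
noncomputable def centeredRep (x : UnitAddCircle) : ℝ := (AddCircle.equivIoc 1 (-1/2) x : ℝ)

/-- The representative in `(0, 1]` of a point of the circle `ℝ / ℤ`. -/
noncomputable def unitRep (x : UnitAddCircle) : ℝ := (AddCircle.equivIoc 1 0 x : ℝ)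

theorem coe_centeredRep (x : UnitAddCircle) : (centeredRep x : UnitAddCircle) = x :=
  AddCircle.coe_equivIoc

theorem centeredRep_mem (x : UnitAddCircle) : -1/2 < centeredRep x ∧ centeredRep x ≤ 1/2 := by
  have := (AddCircle.equivIoc 1 (-1/2) x).2
  refine ⟨this.1, this.2.trans (by norm_num)⟩

theorem unitRep_mem (x : UnitAddCircle) : 0 < unitRep x ∧ unitRep x ≤ 1 := by
  have := (AddCircle.equivIoc 1 0 x).2
  refine ⟨this.1, this.2.trans (by norm_num)⟩

theorem abs_centeredRep_le (x : UnitAddCircle) : |centeredRep x| ≤ 1/2 := by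
  have := centeredRep_mem x
  rw [abs_le]; constructor <;> linarith

@[fun_prop]
theorem measurable_centeredRep : Measurable centeredRep :=
  measurable_subtype_coe.comp (AddCircle.measurableEquivIoc 1 (-1/2)).measurable

@[fun_prop]
theorem measurable_unitRep : Measurable unitRep :=
  measurable_subtype_coe.comp (AddCircle.measurableEquivIoc 1 0).measurable

theorem centeredRep_coe {y : ℝ} (h : -1/2 < y) (h' : y ≤ 1/2) :
    centeredRep (y : UnitAddCircle) = y :=
  AddCircle.equivIoc_coe_of_mem ⟨h, by linarith⟩

theorem unitRep_coe {y : ℝ} (h : 0 < y) (h' : y ≤ 1) : unitRep (y : UnitAddCircle) = y :=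
  AddCircle.equivIoc_coe_of_mem ⟨h, by linarith⟩

theorem centeredRep_neg {x : UnitAddCircle} (h : x ≠ ((1/2 : ℝ) : UnitAddCircle)) :
    centeredRep (-x) = -centeredRep x := by
  have hm := centeredRep_mem x
  have h2 : centeredRep x ≠ 1/2 := fun h' => h (by rw [← h', coe_centeredRep])
  have h3 := lt_of_le_of_ne hm.2 h2
  have : -x = ((-centeredRep x : ℝ) : UnitAddCircle) := by
    rw [AddCircle.coe_neg, coe_centeredRep]
  rw [this, centeredRep_coe] <;> linarith [hm.1]

theorem centeredRep_injective : Function.Injective centeredRep := fun x y h => by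
  rw [← coe_centeredRep x, h, coe_centeredRep]

theorem centeredRep_zero : centeredRep 0 = 0 := by
  have := centeredRep_coe (y := 0) (by norm_num) (by norm_num)
  simpa using this

/-- The step from `y` to `x` around the circle exceeds the difference of the centered
representatives by one exactly when the representatives descend. -/
theorem unitRep_sub {x y : UnitAddCircle} (h : x ≠ y) :
    unitRep (x - y) =
      centeredRep x - centeredRep y + if centeredRep x < centeredRep y then 1 else 0 := by
  have hx := centeredRep_mem x
  have hy := centeredRep_mem y
  have hne : centeredRep x ≠ centeredRep y := fun h' => h (centeredRep_injective h')
  have e : x - y = ((centeredRep x - centeredRep y : ℝ) : UnitAddCircle) := by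
    rw [AddCircle.coe_sub, coe_centeredRep, coe_centeredRep]
  split_ifs with h'
  · have e' : x - y = ((centeredRep x - centeredRep y + 1 : ℝ) : UnitAddCircle) := by
      rw [e, AddCircle.coe_add_period 1]
    rw [e', unitRep_coe] <;> linarith
  · have := lt_of_le_of_ne (not_lt.1 h') hne.symm
    rw [e, unitRep_coe] <;> linarith

theorem integral_comp_centeredRep (f : ℝ → ℝ) :
    ∫ x : UnitAddCircle, f (centeredRep x) = ∫ y in (-1/2 : ℝ)..1/2, f y := by
  have := UnitAddCircle.intervalIntegral_preimage (-1/2) (fun x => f (centeredRep x))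
  rw [← this, show (-1/2 + 1 : ℝ) = 1/2 by norm_num]
  refine intervalIntegral.integral_congr_ae (ae_of_all _ fun y hy => ?_)
  rw [Set.uIoc_of_le (by norm_num)] at hy
  rw [centeredRep_coe hy.1 hy.2]

theorem integral_comp_unitRep (f : ℝ → ℝ) :
    ∫ x : UnitAddCircle, f (unitRep x) = ∫ y in (0 : ℝ)..1, f y := by
  have := UnitAddCircle.intervalIntegral_preimage 0 (fun x => f (unitRep x))
  rw [← this, zero_add]
  refine intervalIntegral.integral_congr_ae (ae_of_all _ fun y hy => ?_)
  rw [Set.uIoc_of_le (by norm_num)] at hy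
  rw [unitRep_coe hy.1 hy.2]

instance : IsProbabilityMeasure (volume : Measure UnitAddCircle) := ⟨UnitAddCircle.measure_univ⟩

section generic

variable {n : ℕ}

/-- A point of the torus is generic if its centered representatives are distinct in absolute
value, nonzero and different from `1/2`. -/
def IsGenericTorusPoint (V : Fin n → UnitAddCircle) : Prop :=
  (∀ i, V i ≠ 0 ∧ V i ≠ ((1/2 : ℝ) : UnitAddCircle)) ∧
    ∀ i j, i ≠ j → V i - V j ≠ 0 ∧ V i + V j ≠ 0

/-- Surjective homomorphisms from the torus to a compact group carry the uniform distribution to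
the uniform distribution. -/
theorem measurePreserving_of_surjective {G : Type*} [AddCommGroup G] [TopologicalSpace G]
    [IsTopologicalAddGroup G] [MeasureSpace G] [BorelSpace G] [CompactSpace G]
    [IsProbabilityMeasure (volume : Measure G)] [(volume : Measure G).IsAddHaarMeasure]
    (φ : (Fin n → UnitAddCircle) →+ G) (hc : Continuous φ) (hs : Function.Surjective φ) :
    MeasurePreserving φ := by
  refine AddMonoidHom.measurePreserving hc hs (by simp)

theorem measurePreserving_eval (i : Fin n) :
    MeasurePreserving (fun V : Fin n → UnitAddCircle => V i) :=
  measurePreserving_of_surjective (Pi.evalAddMonoidHom _ i) (continuous_apply i)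
    (Function.surjective_eval i)

theorem ae_isGenericTorusPoint : ∀ᵐ V : Fin n → UnitAddCircle, IsGenericTorusPoint V := by
  have hne : ∀ c : UnitAddCircle, ∀ᵐ x : UnitAddCircle, x ≠ c := fun c => by
    have := AddCircle.volume_closedBall 1 (x := c) 0
    rw [Metric.closedBall_zero] at this
    simp [ae_iff, this]
  have key : ∀ φ : (Fin n → UnitAddCircle) →+ UnitAddCircle, Continuous φ →
      Function.Surjective φ → ∀ c, ∀ᵐ V, φ V ≠ c := fun φ hc hs c =>
    (measurePreserving_of_surjective φ hc hs).quasiMeasurePreserving.ae (hne c)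
  let e : Fin n → (Fin n → UnitAddCircle) →+ UnitAddCircle := Pi.evalAddMonoidHom _
  have h1 : ∀ i, ∀ c : UnitAddCircle, ∀ᵐ V : Fin n → UnitAddCircle, V i ≠ c := fun i =>
    key (e i) (continuous_apply i) (Function.surjective_eval i)
  have h2 : ∀ i j : Fin n, i ≠ j → ∀ᵐ V : Fin n → UnitAddCircle, V i - V j ≠ 0 := fun i j hij =>
    key (e i - e j) ((continuous_apply i).sub (continuous_apply j))
      (fun a => ⟨Pi.single i a, by simp [e, hij.symm]⟩) 0
  have h3 : ∀ i j : Fin n, i ≠ j → ∀ᵐ V : Fin n → UnitAddCircle, V i + V j ≠ 0 := fun i j hij =>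
    key (e i + e j) ((continuous_apply i).add (continuous_apply j))
      (fun a => ⟨Pi.single i a, by simp [e, hij.symm]⟩) 0
  unfold IsGenericTorusPoint
  simp only [ne_eq] at *
  refine eventually_and.2 ⟨eventually_all.2 fun i => (h1 i _).and (h1 i _), ?_⟩
  refine eventually_all.2 fun i => eventually_all.2 fun j => ?_
  by_cases hij : i = j
  · simp [hij]
  · filter_upwards [h2 i j hij, h3 i j hij] with V a b _ using ⟨a, b⟩

end generic

/-! ### Descents of a random signed permutation and of a random point of the torus -/

section averaging

variable {n : ℕ}

/-- The number of descents of `0` followed by the centered representatives of `V`. -/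
noncomputable def torusDes (V : Fin n → UnitAddCircle) : ℕ := seqDes fun j => centeredRep (V j)

theorem measurable_prevEntry_centeredRep (i : Fin n) :
    Measurable fun V : Fin n → UnitAddCircle => prevEntry (fun j => centeredRep (V j)) i := by
  unfold prevEntry
  split_ifs <;> fun_prop

theorem measurable_torusDes : Measurable (torusDes : (Fin n → UnitAddCircle) → ℕ) := by
  unfold torusDes seqDes
  simp only [Finset.card_filter]
  refine Finset.measurable_fun_sum _ fun i _ => ?_
  exact Measurable.ite (measurableSet_lt (by fun_prop) (measurable_prevEntry_centeredRep i))
    measurable_const measurable_const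

theorem torusDes_le (V : Fin n → UnitAddCircle) : torusDes V ≤ n :=
  (Finset.card_filter_le _ _).trans_eq (Finset.card_fin n)

theorem integrable_comp_torusDes {E : Type*} [NormedAddCommGroup E] (g : ℕ → E) :
    Integrable fun V : Fin n → UnitAddCircle => g (torusDes V) := by
  refine Integrable.of_bound (C := ∑ k ∈ Finset.range (n + 1), ‖g k‖) ?_ (ae_of_all _ fun V => ?_)
  · exact (StronglyMeasurable.of_discrete (f := g)).comp_measurable
      measurable_torusDes |>.aestronglyMeasurable
  · exact Finset.single_le_sum (f := fun k => ‖g k‖) (fun _ _ => norm_nonneg _)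
      (Finset.mem_range.2 (Nat.lt_succ_of_le (torusDes_le V)))

/-- Replacing the values `1, …, n` by the terms of any increasing sequence of positive reals does
not change the descents of a signed permutation. -/
theorem seqDes_sign_mul {a : Fin n → ℝ} (ha : StrictMono a) (ha0 : ∀ i, 0 < a i)
    (u : Equiv.Perm (Fin n)) (s : Fin n → ℤˣ) :
    seqDes (fun j => ((s j : ℤ) : ℝ) * a (u j)) = seqDes (signedWindow u s) := by
  refine seqDes_congr (fun i j => ?_) (fun i => ?_)
  · have hi := ha0 (u i)
    have hj := ha0 (u j)
    have hlt : ∀ i j, a i < a j ↔ i.1 < j.1 := fun i j => ha.lt_iff_lt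
    unfold signedWindow
    rcases Int.units_eq_one_or (s i) with h | h <;>
      rcases Int.units_eq_one_or (s j) with h' | h' <;>
      rw [h, h'] <;> simp [hlt]
    · constructor <;> intro <;> linarith
    · constructor <;> intro <;> linarith
    · rw [Fin.lt_def]; omega
  · have hi := ha0 (u i)
    rw [signedWindow_neg_iff]
    rcases Int.units_eq_one_or (s i) with h | h <;> rw [h] <;> simp [hi, hi.le]

/-- Among the images of a generic point under all signed permutations, the number of descents is
distributed as `des_B` on `B_n`: sorting the absolute values reduces this to a translation of
`B_n`. -/
theorem sum_signed_images {E : Type*} [AddCommMonoid E] {v : Fin n → ℝ} (h0 : ∀ i, v i ≠ 0)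
    (hv : Function.Injective fun i => |v i|) (g : ℕ → E) :
    ∑ u : Equiv.Perm (Fin n), ∑ s : Fin n → ℤˣ,
        g (seqDes fun j => ((s j : ℤ) : ℝ) * v (u j)) =
      ∑ u : Equiv.Perm (Fin n), ∑ s : Fin n → ℤˣ, g (seqDes (signedWindow u s)) := by
  let σ := Tuple.sort fun i => |v i|
  let τ : Fin n → ℤˣ := fun i => if v i < 0 then -1 else 1
  have hτ : ∀ i, v i = ((τ i : ℤ) : ℝ) * |v i| := by
    intro i
    simp only [τ]
    split_ifs with h
    · rw [abs_of_neg h]; simp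
    · rw [abs_of_nonneg (not_lt.1 h)]; simp
  have hmono : StrictMono fun i => |v (σ i)| :=
    (Tuple.monotone_sort fun i => |v i|).strictMono_of_injective (hv.comp σ.injective)
  -- the signed permutation that sorts `v` is absorbed by `u ↦ σ⁻¹ * u`, `s j ↦ s j * τ (u j)`
  refine Fintype.sum_equiv (Equiv.mulLeft σ⁻¹) _ _ fun u => ?_
  refine Fintype.sum_equiv (Equiv.mulRight fun j => τ (u j)) _ _ fun s => ?_
  rw [← seqDes_sign_mul hmono fun i => abs_pos.2 (h0 _)]
  congr 2
  ext j
  conv_lhs => rw [hτ]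
  simp [mul_assoc]

theorem IsGenericTorusPoint.centeredRep_ne_zero {V : Fin n → UnitAddCircle}
    (hV : IsGenericTorusPoint V) (i : Fin n) : centeredRep (V i) ≠ 0 := fun h =>
  (hV.1 i).1 (centeredRep_injective (h.trans centeredRep_zero.symm))

theorem IsGenericTorusPoint.abs_centeredRep_injective {V : Fin n → UnitAddCircle}
    (hV : IsGenericTorusPoint V) : Function.Injective fun i => |centeredRep (V i)| := by
  intro i j hij
  by_contra hne
  rcases abs_eq_abs.1 hij with h | h
  · exact (hV.2 i j hne).1 (sub_eq_zero.2 (centeredRep_injective h))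
  · rw [← centeredRep_neg (hV.1 j).2] at h
    exact (hV.2 i j hne).2 (by rw [centeredRep_injective h, neg_add_cancel])

/-- The action of a signed permutation on the torus. -/
def torusAction (u : Equiv.Perm (Fin n)) (s : Fin n → ℤˣ) :
    (Fin n → UnitAddCircle) →+ (Fin n → UnitAddCircle) where
  toFun V j := (s j : ℤ) • V (u j)
  map_zero' := by ext; simp
  map_add' _ _ := by ext; simp

theorem measurePreserving_torusAction (u : Equiv.Perm (Fin n)) (s : Fin n → ℤˣ) :
    MeasurePreserving (torusAction u s) := by
  refine measurePreserving_of_surjective _ ?_ fun V => ⟨fun j => (s (u⁻¹ j) : ℤ) • V (u⁻¹ j), ?_⟩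
  · exact continuous_pi fun j => (continuous_apply (u j)).zsmul _
  · ext j
    rcases Int.units_eq_one_or (s j) with h | h <;> simp [torusAction, h]

theorem torusDes_torusAction {V : Fin n → UnitAddCircle} (hV : IsGenericTorusPoint V)
    (u : Equiv.Perm (Fin n)) (s : Fin n → ℤˣ) :
    torusDes (torusAction u s V) = seqDes fun j => ((s j : ℤ) : ℝ) * centeredRep (V (u j)) := by
  unfold torusDes
  congr 1
  ext j
  rcases Int.units_eq_one_or (s j) with h | h <;> simp [torusAction, h]
  exact centeredRep_neg (hV.1 _).2

/-- The distribution of `des_B` on `B_n` is that of the number of descents of a uniformly random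
point of the torus. -/
theorem sum_desB_eq_integral {E : Type*} [NormedAddCommGroup E] [NormedSpace ℝ E] [CompleteSpace E]
    (g : ℕ → E) :
    ∑ w : SignedPerm n, g w.desB =
      (Fintype.card (SignedPerm n) : ℝ) • ∫ V : Fin n → UnitAddCircle, g (torusDes V) := by
  have key : ∀ u s, ∫ V : Fin n → UnitAddCircle, g (torusDes (torusAction u s V)) =
      ∫ V : Fin n → UnitAddCircle, g (torusDes V) := by
    intro u s
    have hm := measurePreserving_torusAction u s
    have hg : AEStronglyMeasurable (fun V => g (torusDes V))
        (Measure.map (torusAction u s) volume) := by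
      rw [hm.map_eq]
      exact (integrable_comp_torusDes g).aestronglyMeasurable
    rw [← integral_map hm.measurable.aemeasurable hg, hm.map_eq]
  have hint : ∀ u s, Integrable fun V : Fin n → UnitAddCircle =>
      g (torusDes (torusAction u s V)) := fun u s =>
    (measurePreserving_torusAction u s).integrable_comp_of_integrable (integrable_comp_torusDes g)
  have h1 : ∫ V : Fin n → UnitAddCircle, ∑ u, ∑ s, g (torusDes (torusAction u s V)) =
      (Fintype.card (SignedPerm n) : ℝ) • ∫ V : Fin n → UnitAddCircle, g (torusDes V) := by
    rw [integral_finsetSum _ fun u _ => integrable_finsetSum _ fun s _ => hint u s]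
    simp_rw [integral_finsetSum _ fun s _ => hint _ s, key]
    simp only [Finset.sum_const, Finset.card_univ, ← Nat.cast_smul_eq_nsmul ℝ, smul_smul]
    rw [Fintype.card_congr (SignedPerm.equivProd n), Fintype.card_prod]
    push_cast
    rfl
  rw [← h1, SignedPerm.sum_eq_sum_prod fun _ k => g k]
  have h2 : ∀ᵐ V : Fin n → UnitAddCircle, ∑ u, ∑ s, g (torusDes (torusAction u s V)) =
      ∑ u : Equiv.Perm (Fin n), ∑ s : Fin n → ℤˣ, g (seqDes (signedWindow u s)) := by
    filter_upwards [ae_isGenericTorusPoint] with V hV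
    rw [← sum_signed_images hV.centeredRep_ne_zero hV.abs_centeredRep_injective]
    simp_rw [torusDes_torusAction hV]
  rw [integral_congr_ae h2]
  simp

end averaging

/-! ### Descents as turns around the circle, and their moments -/

section steps

theorem sum_sub_prevEntry {m : ℕ} (x : Fin (m + 1) → ℝ) :
    ∑ i, (x i - prevEntry x i) = x (Fin.last m) := by
  induction m with
  | zero => simp [prevEntry]
  | succ m ih =>
    rw [Fin.sum_univ_castSucc]
    have h := ih fun i => x i.castSucc
    have h1 : ∀ i : Fin (m + 1),
        prevEntry x i.castSucc = prevEntry (fun i => x i.castSucc) i := fun i => rfl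
    have h2 : prevEntry x (Fin.last (m + 1)) = x (Fin.last m).castSucc := by
      rw [prevEntry, if_neg (by simp)]
      rfl
    simp_rw [h1, h, h2]
    ring

variable {n m : ℕ}

theorem prevEntry_add {M : Type*} [AddZeroClass M] (x y : Fin n → M) (i : Fin n) :
    prevEntry (x + y) i = prevEntry x i + prevEntry y i := by
  unfold prevEntry
  split_ifs <;> simp

/-- The differences between consecutive coordinates of a point of the torus, preceded by `0`. -/
def torusSteps (n : ℕ) : (Fin n → UnitAddCircle) →+ (Fin n → UnitAddCircle) where
  toFun V i := V i - prevEntry V i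
  map_zero' := by ext i; simp [prevEntry]
  map_add' V W := by
    ext i
    simp only [prevEntry_add, Pi.add_apply]
    abel

theorem continuous_torusSteps : Continuous (torusSteps n) := by
  refine continuous_pi fun i => (continuous_apply i).sub ?_
  unfold prevEntry
  split_ifs
  · exact continuous_const
  · exact continuous_apply _

theorem surjective_torusSteps : Function.Surjective (torusSteps n) := by
  intro U
  refine ⟨fun i => ∑ j ∈ Finset.Iic i, U j, ?_⟩
  ext i
  have : prevEntry (fun i => ∑ j ∈ Finset.Iic i, U j) i = ∑ j ∈ Finset.Iio i, U j := by
    unfold prevEntry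
    split_ifs with h
    · symm
      refine Finset.sum_eq_zero fun j hj => ?_
      have : j < i := Finset.mem_Iio.1 hj
      rw [Fin.lt_def] at this
      omega
    · refine Finset.sum_congr ?_ fun _ _ => rfl
      ext j
      simp only [Finset.mem_Iic, Finset.mem_Iio, Fin.le_def, Fin.lt_def]
      omega
  change (∑ j ∈ Finset.Iic i, U j) - prevEntry (fun i => ∑ j ∈ Finset.Iic i, U j) i = _
  rw [this, ← Finset.Iio_insert, Finset.sum_insert (by simp)]
  abel

theorem measurePreserving_torusSteps : MeasurePreserving (torusSteps n) :=
  measurePreserving_of_surjective _ continuous_torusSteps surjective_torusSteps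

/-- The number of descents is the number of turns around the circle: the total length of the
steps, minus the endpoint. -/
theorem torusDes_eq {V : Fin (m + 1) → UnitAddCircle} (hV : IsGenericTorusPoint V) :
    (torusDes V : ℝ) =
      ∑ i, unitRep (torusSteps _ V i) - centeredRep (V (Fin.last m)) := by
  have hprev : ∀ i, prevEntry (fun j => centeredRep (V j)) i = centeredRep (prevEntry V i) := by
    intro i
    unfold prevEntry
    split_ifs
    · exact centeredRep_zero.symm
    · rfl
  have h : ∀ i, unitRep (torusSteps _ V i) =
      (centeredRep (V i) - prevEntry (fun j => centeredRep (V j)) i) +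
        if centeredRep (V i) < prevEntry (fun j => centeredRep (V j)) i then 1 else 0 := by
    intro i
    rw [hprev]
    refine unitRep_sub ?_
    unfold prevEntry
    split_ifs with h
    · exact (hV.1 i).1
    · exact fun h' => (hV.2 i ⟨i.1 - 1, by omega⟩
        (fun h'' => by have := congrArg Fin.val h''; simp at this; omega)).1 (sub_eq_zero.2 h')
  simp_rw [h]
  rw [Finset.sum_add_distrib, sum_sub_prevEntry (fun j => centeredRep (V j)), torusDes, seqDes,
    Finset.card_filter]
  push_cast
  ring

/-- The representative in `(0, 1]`, minus its mean `1/2` under the uniform distribution. -/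
noncomputable def centeredStep (x : UnitAddCircle) : ℝ := unitRep x - 1 / 2

@[fun_prop]
theorem measurable_centeredStep : Measurable centeredStep := by
  unfold centeredStep; fun_prop

theorem abs_centeredStep_le (x : UnitAddCircle) : |centeredStep x| ≤ 1 := by
  have := unitRep_mem x
  unfold centeredStep
  rw [abs_le]; constructor <;> linarith

theorem torusDes_sub_eq {V : Fin (m + 1) → UnitAddCircle} (hV : IsGenericTorusPoint V) :
    (torusDes V : ℝ) - ((m + 1 : ℕ) : ℝ) / 2 =
      ∑ i, centeredStep (torusSteps _ V i) - centeredRep (V (Fin.last m)) := by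
  rw [torusDes_eq hV]
  simp only [centeredStep, Finset.sum_sub_distrib]
  simp [div_eq_mul_inv]
  ring

theorem integral_centeredStep : ∫ x, centeredStep x = 0 := by
  refine (integral_comp_unitRep fun y => y - 1 / 2).trans ?_
  simp

theorem integral_centeredStep_sq : ∫ x, centeredStep x ^ 2 = 1 / 12 := by
  refine (integral_comp_unitRep fun y => (y - 1 / 2) ^ 2).trans ?_
  rw [intervalIntegral.integral_comp_sub_right (fun y => y ^ 2), integral_pow]
  norm_num

theorem integral_centeredRep : ∫ x, centeredRep x = 0 := by
  refine (integral_comp_centeredRep fun y => y).trans ?_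
  rw [integral_id]; norm_num

theorem integral_centeredRep_sq : ∫ x, centeredRep x ^ 2 = 1 / 12 := by
  refine (integral_comp_centeredRep fun y => y ^ 2).trans ?_
  rw [integral_pow]; norm_num

theorem integral_comp_of_measurePreserving {α β E : Type*} [MeasurableSpace α] [MeasurableSpace β]
    {μ : Measure α} {ν : Measure β} {φ : α → β} [NormedAddCommGroup E] [NormedSpace ℝ E]
    (h : MeasurePreserving φ μ ν) {f : β → E} (hf : AEStronglyMeasurable f ν) :
    ∫ x, f (φ x) ∂μ = ∫ y, f y ∂ν := by
  rw [← h.map_eq, integral_map h.measurable.aemeasurable (by rwa [h.map_eq])]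

instance : (volume : Measure (UnitAddCircle × UnitAddCircle)).IsAddHaarMeasure :=
  inferInstanceAs ((volume : Measure UnitAddCircle).prod volume).IsAddHaarMeasure

/-- The two components of a surjective homomorphism from the torus to the product of two circles
are independent and uniformly distributed. -/
theorem integral_mul_of_surjective (φ : (Fin n → UnitAddCircle) →+ UnitAddCircle × UnitAddCircle)
    (hc : Continuous φ) (hs : Function.Surjective φ) {f g : UnitAddCircle → ℝ}
    (hf : Measurable f) (hg : Measurable g) :
    ∫ V, f (φ V).1 * g (φ V).2 = (∫ x, f x) * ∫ x, g x := by
  rw [integral_comp_of_measurePreserving (measurePreserving_of_surjective φ hc hs)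
    (f := fun p => f p.1 * g p.2) (by fun_prop)]
  exact integral_prod_mul f g

theorem measurable_torusSteps : Measurable (torusSteps n) := measurePreserving_torusSteps.measurable

theorem integral_centeredStep_mul (i j : Fin n) :
    ∫ V, centeredStep (torusSteps n V i) * centeredStep (torusSteps n V j) =
      if i = j then 1 / 12 else 0 := by
  have h := integral_comp_of_measurePreserving (measurePreserving_torusSteps (n := n))
    (f := fun U => centeredStep (U i) * centeredStep (U j)) (by fun_prop)
  rw [h]
  split_ifs with hij
  · subst hij
    have h := integral_comp_of_measurePreserving (measurePreserving_eval (n := n) i)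
      (f := fun x => centeredStep x ^ 2) (by fun_prop)
    simp_rw [← pow_two]
    rw [h, integral_centeredStep_sq]
  · let φ : (Fin n → UnitAddCircle) →+ UnitAddCircle × UnitAddCircle :=
      (Pi.evalAddMonoidHom _ i).prod (Pi.evalAddMonoidHom _ j)
    have h := integral_mul_of_surjective φ ((continuous_apply i).prodMk (continuous_apply j))
      (fun p => ⟨Pi.single i p.1 + Pi.single j p.2, by simp [φ, hij, Ne.symm hij]⟩)
      measurable_centeredStep measurable_centeredStep
    rw [integral_centeredStep, zero_mul] at h
    exact h

/-- Each step is independent of the endpoint if there are at least two steps. -/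
theorem integral_centeredStep_mul_centeredRep (hm : 1 ≤ m) (i : Fin (m + 1)) :
    ∫ V, centeredStep (torusSteps _ V i) * centeredRep (V (Fin.last m)) = 0 := by
  let φ : (Fin (m + 1) → UnitAddCircle) →+ UnitAddCircle × UnitAddCircle :=
    ((Pi.evalAddMonoidHom _ i).comp (torusSteps _)).prod (Pi.evalAddMonoidHom _ (Fin.last m))
  have hc : Continuous φ :=
    ((continuous_apply i).comp continuous_torusSteps).prodMk (continuous_apply _)
  have hs : Function.Surjective φ := by
    rintro ⟨a, b⟩
    by_cases hi : i = Fin.last m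
    · -- for the last step, the previous coordinate is free since `1 ≤ m`
      refine ⟨(Pi.single (Fin.last m) b + Pi.single ⟨m - 1, by omega⟩ (b - a) :
        Fin (m + 1) → UnitAddCircle), ?_⟩
      have h1 : (⟨m - 1, by omega⟩ : Fin (m + 1)) ≠ Fin.last m := fun h => by
        have := congrArg Fin.val h; simp at this; omega
      have h2 : m ≠ 0 := by omega
      simp [φ, torusSteps, prevEntry, hi, h1, h1.symm, h2]
    · let W : Fin (m + 1) → UnitAddCircle := Pi.single i a + Pi.single (Fin.last m) b
      refine ⟨W, ?_⟩
      have h2 : ∀ h : i.1 - 1 < m + 1, i.1 ≠ 0 → (⟨i.1 - 1, h⟩ : Fin (m + 1)) ≠ i := fun _ _ h => by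
        have := congrArg Fin.val h; simp at this; omega
      have h3 : ∀ h : i.1 - 1 < m + 1, (⟨i.1 - 1, h⟩ : Fin (m + 1)) ≠ Fin.last m := fun _ h => by
        have := congrArg Fin.val h; simp at this; omega
      have h4 : prevEntry W i = 0 := by
        unfold prevEntry
        split_ifs with h
        · rfl
        · simp [W, h2 _ h, h3]
      ext
      · change W i - prevEntry W i = a
        rw [h4]
        simp [W, hi]
      · simp [φ, W, Ne.symm hi]
  have h := integral_mul_of_surjective φ hc hs measurable_centeredStep measurable_centeredRep
  rw [integral_centeredStep, zero_mul] at h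
  exact h

theorem measurable_centeredStep_torusSteps (i : Fin n) :
    Measurable fun V => centeredStep (torusSteps n V i) :=
  measurable_centeredStep.comp ((measurable_pi_apply i).comp measurable_torusSteps)

theorem abs_sum_centeredStep_le (V : Fin n → UnitAddCircle) :
    |∑ i, centeredStep (torusSteps n V i)| ≤ n :=
  (Finset.abs_sum_le_sum_abs _ _).trans ((Finset.sum_le_sum fun i _ => abs_centeredStep_le _).trans
    (by simp))

theorem measurable_sum_centeredStep :
    Measurable fun V => ∑ i, centeredStep (torusSteps n V i) :=
  Finset.measurable_fun_sum _ fun i _ => measurable_centeredStep_torusSteps i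

theorem integrable_of_abs_le {f : (Fin n → UnitAddCircle) → ℝ} (hf : Measurable f) (C : ℝ)
    (h : ∀ V, |f V| ≤ C) : Integrable f :=
  Integrable.of_bound hf.aestronglyMeasurable C (ae_of_all _ h)

theorem integrable_centeredStep_mul (i j : Fin n) :
    Integrable fun V => centeredStep (torusSteps n V i) * centeredStep (torusSteps n V j) := by
  refine integrable_of_abs_le ((measurable_centeredStep_torusSteps i).mul
    (measurable_centeredStep_torusSteps j)) 1 fun V => ?_
  rw [abs_mul]
  exact mul_le_one₀ (abs_centeredStep_le _) (abs_nonneg _) (abs_centeredStep_le _)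

theorem integrable_centeredStep_mul_centeredRep (i j : Fin n) :
    Integrable fun V => centeredStep (torusSteps n V i) * centeredRep (V j) := by
  refine integrable_of_abs_le ((measurable_centeredStep_torusSteps i).mul
    (by fun_prop)) 1 fun V => ?_
  rw [abs_mul]
  exact mul_le_one₀ (abs_centeredStep_le _) (abs_nonneg _)
    ((abs_centeredRep_le _).trans (by norm_num))

theorem integrable_sum_centeredStep_sq :
    Integrable fun V => (∑ i, centeredStep (torusSteps n V i)) ^ 2 :=
  integrable_of_abs_le (measurable_sum_centeredStep.pow_const 2) ((n : ℝ) ^ 2) fun V => by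
    rw [abs_pow]
    exact pow_le_pow_left₀ (abs_nonneg _) (abs_sum_centeredStep_le V) 2

theorem integral_sum_centeredStep_sq :
    ∫ V, (∑ i, centeredStep (torusSteps n V i)) ^ 2 = (n : ℝ) / 12 := by
  simp_rw [pow_two, Finset.sum_mul_sum]
  rw [integral_finsetSum _ fun i _ => integrable_finsetSum _ fun j _ =>
    integrable_centeredStep_mul i j]
  simp_rw [integral_finsetSum _ fun j _ => integrable_centeredStep_mul _ j,
    integral_centeredStep_mul]
  simp
  ring

theorem integral_torusDes_sub :
    ∫ V : Fin (m + 1) → UnitAddCircle, ((torusDes V : ℝ) - ((m + 1 : ℕ) : ℝ) / 2) = 0 := by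
  rw [integral_congr_ae (ae_isGenericTorusPoint.mono fun V hV => torusDes_sub_eq hV)]
  have h1 : ∀ i : Fin (m + 1), ∫ V, centeredStep (torusSteps _ V i) = 0 := by
    intro i
    rw [← integral_centeredStep]
    exact integral_comp_of_measurePreserving
      ((measurePreserving_eval i).comp measurePreserving_torusSteps) (by fun_prop)
  have h2 : ∫ V : Fin (m + 1) → UnitAddCircle, centeredRep (V (Fin.last m)) = 0 := by
    rw [← integral_centeredRep]
    exact integral_comp_of_measurePreserving (measurePreserving_eval _) (by fun_prop)
  have h3 : ∀ i : Fin (m + 1), Integrable fun V => centeredStep (torusSteps _ V i) := fun i =>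
    integrable_of_abs_le (measurable_centeredStep_torusSteps i) 1 fun V => abs_centeredStep_le _
  rw [integral_sub (integrable_finsetSum _ fun i _ => h3 i)
    (integrable_of_abs_le (by fun_prop) _ fun V => abs_centeredRep_le _),
    integral_finsetSum _ fun i _ => h3 i, h2]
  simp [h1]

/-- The endpoint is uncorrelated with the steps, so the variance of the number of descents is the
sum of `(m + 1) / 12` for the steps and `1 / 12` for the endpoint. -/
theorem integral_torusDes_sub_sq (hm : 1 ≤ m) :
    ∫ V : Fin (m + 1) → UnitAddCircle, ((torusDes V : ℝ) - ((m + 1 : ℕ) : ℝ) / 2) ^ 2 =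
      (((m + 1 : ℕ) : ℝ) + 1) / 12 := by
  have e : ∀ᵐ V : Fin (m + 1) → UnitAddCircle,
      ((torusDes V : ℝ) - ((m + 1 : ℕ) : ℝ) / 2) ^ 2 =
        (∑ i, centeredStep (torusSteps _ V i)) ^ 2 -
          2 * ∑ i, centeredStep (torusSteps _ V i) * centeredRep (V (Fin.last m)) +
          centeredRep (V (Fin.last m)) ^ 2 := by
    filter_upwards [ae_isGenericTorusPoint] with V hV
    rw [torusDes_sub_eq hV, ← Finset.sum_mul]
    ring
  have h2 : ∫ V : Fin (m + 1) → UnitAddCircle, centeredRep (V (Fin.last m)) ^ 2 = 1 / 12 := by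
    rw [← integral_centeredRep_sq]
    exact integral_comp_of_measurePreserving (measurePreserving_eval _)
      (f := fun x => centeredRep x ^ 2) (by fun_prop)
  have i1 : Integrable fun V : Fin (m + 1) → UnitAddCircle =>
      2 * ∑ i, centeredStep (torusSteps _ V i) * centeredRep (V (Fin.last m)) :=
    (integrable_finsetSum _ fun i _ => integrable_centeredStep_mul_centeredRep i _).const_mul 2
  have i2 : Integrable fun V : Fin (m + 1) → UnitAddCircle => centeredRep (V (Fin.last m)) ^ 2 :=
    integrable_of_abs_le (by fun_prop) ((1 / 2) ^ 2) fun V => by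
      rw [abs_pow]
      exact pow_le_pow_left₀ (abs_nonneg _) (abs_centeredRep_le _) 2
  have i3 : Integrable fun V : Fin (m + 1) → UnitAddCircle =>
      (∑ i, centeredStep (torusSteps _ V i)) ^ 2 -
        2 * ∑ i, centeredStep (torusSteps _ V i) * centeredRep (V (Fin.last m)) :=
    integrable_sum_centeredStep_sq.sub i1
  rw [integral_congr_ae e, integral_add i3 i2,
    integral_sub integrable_sum_centeredStep_sq i1, integral_sum_centeredStep_sq, h2,
    integral_const_mul, integral_finsetSum _ fun i _ => integrable_centeredStep_mul_centeredRep i _]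
  simp_rw [integral_centeredStep_mul_centeredRep hm]
  simp
  ring

end steps

/-! ### Characteristic functions -/

section characteristic

variable {n : ℕ}

theorem norm_cexp_sub_cexp_le (a b : ℝ) :
    ‖Complex.exp (a * Complex.I) - Complex.exp (b * Complex.I)‖ ≤ |a - b| := by
  have h : Complex.exp (a * Complex.I) - Complex.exp (b * Complex.I) =
      Complex.exp (b * Complex.I) * (Complex.exp (Complex.I * ((a - b : ℝ) : ℂ)) - 1) := by
    rw [mul_sub, ← Complex.exp_add, mul_one]
    congr 2
    push_cast
    ring
  rw [h, norm_mul, Complex.norm_exp_ofReal_mul_I, one_mul]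
  exact Real.norm_exp_I_mul_ofReal_sub_one_le

/-- The steps are independent and uniformly distributed. -/
theorem integral_cexp_sum_centeredStep (τ : ℝ) :
    ∫ V, Complex.exp (((τ * ∑ i, centeredStep (torusSteps n V i) : ℝ) : ℂ) * Complex.I) =
      charFun (volume.map centeredStep) τ ^ n := by
  have h := integral_comp_of_measurePreserving (measurePreserving_torusSteps (n := n))
    (f := fun U => Complex.exp (((τ * ∑ i, centeredStep (U i) : ℝ) : ℂ) * Complex.I))
    (Measurable.aestronglyMeasurable (by fun_prop))
  rw [h, charFun_apply_real, integral_map measurable_centeredStep.aemeasurable (by fun_prop)]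
  have h2 := integral_fintype_prod_volume_eq_pow (ι := Fin n)
    fun x : UnitAddCircle => Complex.exp (τ * centeredStep x * Complex.I)
  rw [Fintype.card_fin] at h2
  rw [← h2]
  congr 1
  ext U
  rw [← Complex.exp_sum]
  push_cast
  rw [Finset.mul_sum, Finset.sum_mul]

theorem tendsto_integral_cexp_sum_centeredStep (t : ℝ) :
    Tendsto (fun n : ℕ => ∫ V, Complex.exp
      ((((√n)⁻¹ * t * √12 * ∑ i, centeredStep (torusSteps n V i) : ℝ) : ℂ) * Complex.I))
      atTop (𝓝 (Complex.exp (-t ^ 2 / 2))) := by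
  have h := tendsto_charFun_inv_sqrt_mul_pow (P := (volume : Measure UnitAddCircle))
    (X := fun x => √12 * centeredStep x) (by fun_prop)
    (by rw [integral_const_mul, integral_centeredStep, mul_zero]) (by
      simp only [Pi.pow_apply, mul_pow]
      rw [integral_const_mul, integral_centeredStep_sq, Real.sq_sqrt (by norm_num)]
      norm_num) t
  refine h.congr fun n => ?_
  rw [integral_cexp_sum_centeredStep, charFun_map_mul_comp measurable_centeredStep.aemeasurable,
    mul_comm]

/-- A bound for the first absolute moment of the sum of the steps by its second moment. -/
theorem integral_abs_sum_centeredStep_le :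
    ∫ V, |∑ i, centeredStep (torusSteps (n + 1) V i)| ≤ √((n + 1 : ℕ) : ℝ) := by
  set r := √((n + 1 : ℕ) : ℝ) with hr
  have hr2 : r ^ 2 = ((n + 1 : ℕ) : ℝ) := Real.sq_sqrt (by positivity)
  have hr0 : 0 < r := Real.sqrt_pos.2 (by positivity)
  have hle : ∀ V, |∑ i, centeredStep (torusSteps (n + 1) V i)| ≤
      (r + r⁻¹ * (∑ i, centeredStep (torusSteps (n + 1) V i)) ^ 2) / 2 := by
    intro V
    set S := ∑ i, centeredStep (torusSteps (n + 1) V i)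
    rw [← sq_abs S]
    -- `2 |S| ≤ r + S ^ 2 / r`
    have : r⁻¹ * (r - |S|) ^ 2 = r + r⁻¹ * |S| ^ 2 - 2 * |S| := by field_simp; ring
    have h2 : 0 ≤ r⁻¹ * (r - |S|) ^ 2 := by positivity
    linarith
  have hi : Integrable fun V =>
      (r + r⁻¹ * (∑ i, centeredStep (torusSteps (n + 1) V i)) ^ 2) / 2 :=
    ((integrable_const r).add (integrable_sum_centeredStep_sq.const_mul _)).div_const 2
  refine (integral_mono ?_ hi hle).trans ?_
  · exact integrable_of_abs_le (measurable_sum_centeredStep.abs) ((n + 1 : ℕ) : ℝ) fun V => by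
      rw [abs_abs]; exact abs_sum_centeredStep_le V
  · rw [integral_div, integral_add (integrable_const r) (integrable_sum_centeredStep_sq.const_mul _),
      integral_const_mul, integral_sum_centeredStep_sq, ← hr2]
    simp only [integral_const, probReal_univ, smul_eq_mul, one_mul]
    field_simp
    norm_num

/-- The number of descents differs from the sum of the steps by a bounded amount, so it satisfies
the same central limit theorem. -/
theorem tendsto_integral_cexp_torusDes (t : ℝ) :
    Tendsto (fun n : ℕ => ∫ V : Fin (n + 1) → UnitAddCircle, Complex.exp
      (((t * (((torusDes V : ℝ) - ((n + 1 : ℕ) : ℝ) / 2) / √((((n + 1 : ℕ) : ℝ) + 1) / 12)) : ℝ) : ℂ) *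
        Complex.I)) atTop (𝓝 (Complex.exp (-t ^ 2 / 2))) := by
  have hA := (tendsto_add_atTop_iff_nat 1).2 (tendsto_integral_cexp_sum_centeredStep t)
  refine (tendsto_iff_of_dist ?_).1 hA
  -- `a n` and `b n` are `t` over the standard deviations of the number of descents and of the sum
  -- of the steps
  let a : ℕ → ℝ := fun n => t / √((((n + 1 : ℕ) : ℝ) + 1) / 12)
  let b : ℕ → ℝ := fun n => (√((n + 1 : ℕ) : ℝ))⁻¹ * t * √12
  have hinv : Tendsto (fun n : ℕ => (√(((n + 1 : ℕ) : ℝ) + 1))⁻¹) atTop (𝓝 0) :=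
    tendsto_inv_atTop_zero.comp (Real.tendsto_sqrt_atTop.comp
      (tendsto_atTop_add_const_right _ _ (tendsto_natCast_atTop_atTop.comp
        (tendsto_add_atTop_nat 1))))
  have ha : ∀ n, a n = t * √12 * (√(((n + 1 : ℕ) : ℝ) + 1))⁻¹ := by
    intro n
    simp only [a]
    rw [Real.sqrt_div (by positivity)]
    field_simp
  have ha0 : Tendsto a atTop (𝓝 0) := by
    simp_rw [funext ha]
    simpa using hinv.const_mul (t * √12)
  have hratio : Tendsto (fun n : ℕ => √((n + 1 : ℕ) : ℝ) * (√(((n + 1 : ℕ) : ℝ) + 1))⁻¹)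
      atTop (𝓝 1) := by
    have h1 : ∀ n : ℕ, √((n + 1 : ℕ) : ℝ) * (√(((n + 1 : ℕ) : ℝ) + 1))⁻¹ =
        √(1 - ((√(((n + 1 : ℕ) : ℝ) + 1))⁻¹) ^ 2) := by
      intro n
      rw [← Real.sqrt_inv, ← Real.sqrt_mul (by positivity), Real.sq_sqrt (by positivity)]
      congr 1
      have : (((n + 1 : ℕ) : ℝ) + 1) ≠ 0 := by positivity
      field_simp
      ring
    simp_rw [h1]
    have := ((tendsto_const_nhds (x := (1 : ℝ))).sub (hinv.pow 2)).sqrt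
    simpa using this
  have hbound : ∀ n, dist
      (∫ V : Fin (n + 1) → UnitAddCircle, Complex.exp
        ((((√((n + 1 : ℕ) : ℝ))⁻¹ * t * √12 *
          ∑ i, centeredStep (torusSteps (n + 1) V i) : ℝ) : ℂ) * Complex.I))
      (∫ V : Fin (n + 1) → UnitAddCircle, Complex.exp
        (((t * (((torusDes V : ℝ) - ((n + 1 : ℕ) : ℝ) / 2) / √((((n + 1 : ℕ) : ℝ) + 1) / 12)) : ℝ) : ℂ) *
          Complex.I)) ≤
      |b n - a n| * √((n + 1 : ℕ) : ℝ) + |a n| / 2 := by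
    intro n
    have hSi : Integrable fun V : Fin (n + 1) → UnitAddCircle =>
        |∑ i, centeredStep (torusSteps (n + 1) V i)| :=
      integrable_of_abs_le (measurable_sum_centeredStep.abs) ((n + 1 : ℕ) : ℝ) fun V => by
        rw [abs_abs]; exact abs_sum_centeredStep_le V
    rw [dist_eq_norm, ← integral_sub]
    · refine (norm_integral_le_of_norm_le (g := fun V => |b n - a n| *
        |∑ i, centeredStep (torusSteps (n + 1) V i)| + |a n| / 2)
        ((hSi.const_mul _).add (integrable_const _)) ?_).trans ?_
      · filter_upwards [ae_isGenericTorusPoint] with V hV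
        refine (norm_cexp_sub_cexp_le _ _).trans ?_
        rw [torusDes_sub_eq hV]
        set S := ∑ i, centeredStep (torusSteps (n + 1) V i)
        have e : (√((n + 1 : ℕ) : ℝ))⁻¹ * t * √12 * S -
            t * ((S - centeredRep (V (Fin.last n))) / √((((n + 1 : ℕ) : ℝ) + 1) / 12)) =
            (b n - a n) * S + a n * centeredRep (V (Fin.last n)) := by
          simp only [a, b]; ring
        rw [e]
        refine (abs_add_le _ _).trans ?_
        rw [abs_mul, abs_mul]
        have := mul_le_mul_of_nonneg_left (abs_centeredRep_le (V (Fin.last n))) (abs_nonneg (a n))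
        linarith
      · rw [integral_add (hSi.const_mul _) (integrable_const _), integral_const_mul]
        simp only [integral_const, probReal_univ, smul_eq_mul, one_mul]
        have := mul_le_mul_of_nonneg_left (integral_abs_sum_centeredStep_le (n := n))
          (abs_nonneg (b n - a n))
        linarith
    · refine Integrable.of_bound (C := 1) ?_ (ae_of_all _ fun V => ?_)
      · have := measurable_sum_centeredStep (n := n + 1)
        exact Measurable.aestronglyMeasurable (by fun_prop)
      · rw [Complex.norm_exp_ofReal_mul_I]
    · exact integrable_comp_torusDes fun k : ℕ => Complex.exp
        (((t * (((k : ℝ) - ((n + 1 : ℕ) : ℝ) / 2) / √((((n + 1 : ℕ) : ℝ) + 1) / 12)) : ℝ) : ℂ) *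
          Complex.I)
  refine squeeze_zero (fun _ => dist_nonneg) hbound ?_
  have hb : ∀ n, |b n - a n| * √((n + 1 : ℕ) : ℝ) =
      |t * √12 * (1 - √((n + 1 : ℕ) : ℝ) * (√(((n + 1 : ℕ) : ℝ) + 1))⁻¹)| := by
    intro n
    have hpos : (0 : ℝ) < √((n + 1 : ℕ) : ℝ) := Real.sqrt_pos.2 (by positivity)
    rw [← abs_of_pos hpos, ← abs_mul, abs_of_pos hpos, ha]
    congr 1
    simp only [b]
    rw [sub_mul, mul_right_comm, mul_right_comm _ t, inv_mul_cancel₀ hpos.ne']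
    ring
  simp_rw [hb]
  have h1 := (((tendsto_const_nhds (x := (1 : ℝ))).sub hratio).const_mul (t * √12)).abs
  simpa using h1.add (ha0.abs.div_const 2)

end characteristic

/-! ### The distribution of the coefficients -/

section coefficients

/-- The distribution of the coefficients of the generating polynomial of a statistic `d` is the law
of `d` at a uniformly random element. -/
theorem coeffDist_sum_X_pow {ι : Type*} (A : Finset ι) (d : ι → ℕ) :
    coeffDist (∑ w ∈ A, Polynomial.X ^ d w) =
      (A.card : ENNReal)⁻¹ • ∑ w ∈ A, Measure.dirac (d w : ℝ) := by
  classical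
  have hcoeff : ∀ k, (∑ w ∈ A, Polynomial.X ^ d w : Polynomial ℕ).coeff k =
      (A.filter fun w => d w = k).card := by
    intro k
    rw [Polynomial.finsetSum_coeff, Finset.card_filter]
    exact Finset.sum_congr rfl fun w _ => by rw [Polynomial.coeff_X_pow]; simp [eq_comm]
  unfold coeffDist
  congr 1
  · simp [Polynomial.eval_finsetSum]
  · have hmaps : ∀ w ∈ A, d w ∈ (∑ w ∈ A, Polynomial.X ^ d w : Polynomial ℕ).support := by
      intro w hw
      rw [Polynomial.mem_support_iff, hcoeff (d w)]
      exact (Finset.card_pos.2 ⟨w, by simp [hw]⟩).ne'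
    rw [← Finset.sum_fiberwise_of_maps_to hmaps fun w => Measure.dirac (d w : ℝ)]
    refine Finset.sum_congr rfl fun k _ => ?_
    rw [hcoeff, Finset.sum_congr rfl (g := fun _ => Measure.dirac (k : ℝ)) fun w hw => by
      rw [(Finset.mem_filter.1 hw).2]]
    rw [Finset.sum_const, Nat.cast_smul_eq_nsmul]

theorem integrable_coeffDist {E : Type*} [NormedAddCommGroup E]
    {p : Polynomial ℕ} (hp : p.eval 1 ≠ 0) (f : ℝ → E) : Integrable f (coeffDist p) := by
  unfold coeffDist
  refine Integrable.smul_measure ?_ (by simp [hp])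
  refine integrable_finsetSum_measure.2 fun k _ => ?_
  exact (integrable_dirac (by simp)).smul_measure (by simp)

variable {n : ℕ}

theorem sum_filter_sgnB {E : Type*} [AddCommGroup E] [Module ℝ E] (ε : ℤˣ)
    (f : SignedPerm n → E) :
    ∑ w : SignedPerm n with w.sgnB = ε, f w =
      (1 / 2 : ℝ) • (∑ w, f w + (ε : ℤ) • ∑ w : SignedPerm n, (w.sgnB : ℤ) • f w) := by
  rw [Finset.sum_filter, Finset.smul_sum, ← Finset.sum_add_distrib, Finset.smul_sum]
  refine Finset.sum_congr rfl fun w _ => ?_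
  rcases Int.units_eq_one_or ε with h | h <;> rcases Int.units_eq_one_or w.sgnB with h' | h' <;>
    rw [h, h'] <;> simp <;> rw [← two_smul ℝ, smul_smul] <;> norm_num

/-- Half of the signed permutations have each of the two signs. -/
theorem card_filter_sgnB (hn : 1 ≤ n) (ε : ℤˣ) :
    ((Finset.univ.filter fun w : SignedPerm n => w.sgnB = ε).card : ℝ) =
      (Fintype.card (SignedPerm n) : ℝ) / 2 := by
  have h := sum_filter_sgnB ε fun _ : SignedPerm n => (1 : ℝ)
  have h0 := sum_sgnB_smul_desB_pow (n := n) (m := 0) (by omega)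
  simp only [pow_zero] at h0
  rw [h0] at h
  simp only [Finset.sum_const, nsmul_eq_mul, mul_one, smul_zero, add_zero, smul_eq_mul,
    Finset.card_univ] at h
  rw [h]; ring

theorem card_signedPerm_pos : (0 : ℝ) < Fintype.card (SignedPerm n) := by
  rw [SignedPerm.card_eq]; positivity

theorem eval_eulerianPolyB_ne_zero (hn : 1 ≤ n) (ε : ℤˣ) : (eulerianPolyB ε n).eval 1 ≠ 0 := by
  have h := card_filter_sgnB hn ε
  have h2 := card_signedPerm_pos (n := n)
  simp only [eulerianPolyB, Polynomial.eval_finsetSum, Polynomial.eval_pow, Polynomial.eval_X,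
    one_pow, Finset.sum_const, smul_eq_mul, mul_one]
  intro h0
  rw [h0] at h
  rw [Nat.cast_zero] at h
  linarith

theorem isProbabilityMeasure_coeffDist (hn : 1 ≤ n) (ε : ℤˣ) :
    IsProbabilityMeasure (coeffDist (eulerianPolyB ε n)) := by
  have h0 := eval_eulerianPolyB_ne_zero hn ε
  constructor
  rw [eulerianPolyB, coeffDist_sum_X_pow]
  simp only [eulerianPolyB, Polynomial.eval_finsetSum, Polynomial.eval_pow, Polynomial.eval_X,
    one_pow, Finset.sum_const, smul_eq_mul, mul_one] at h0
  simp only [Measure.smul_apply, Measure.finsetSum_apply, measure_univ, Finset.sum_const,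
    nsmul_eq_mul, mul_one, smul_eq_mul]
  exact ENNReal.inv_mul_cancel (by simpa using h0) (by simp)

/-- Integrals against the distribution of the coefficients of `B_n^±` are those against the
distribution of `des_B` on all of `B_n`, up to a signed sum. -/
theorem integral_coeffDist {E : Type*} [NormedAddCommGroup E] [NormedSpace ℝ E] [CompleteSpace E]
    (hn : 1 ≤ n) (ε : ℤˣ) (f : ℝ → E) :
    ∫ y, f y ∂(coeffDist (eulerianPolyB ε n)) =
      (∫ V : Fin n → UnitAddCircle, f (torusDes V)) + (Fintype.card (SignedPerm n) : ℝ)⁻¹ •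
        (ε : ℤ) • ∑ w : SignedPerm n, (w.sgnB : ℤ) • f w.desB := by
  have hc := card_signedPerm_pos (n := n)
  rw [eulerianPolyB, coeffDist_sum_X_pow, integral_smul_measure, integral_finsetSum_measure
    fun w _ => integrable_dirac (by simp)]
  simp only [integral_dirac, ENNReal.toReal_inv, ENNReal.toReal_natCast]
  rw [card_filter_sgnB hn, sum_filter_sgnB ε fun w => f w.desB,
    sum_desB_eq_integral fun k => f k, smul_smul, smul_add, smul_smul]
  congr 1
  · rw [show ((Fintype.card (SignedPerm n) : ℝ) / 2)⁻¹ * (1 / 2) * (Fintype.card (SignedPerm n)) = 1 by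
      field_simp, one_smul]
  · congr 1
    field_simp

/-- The moments of order less than `n` agree with those of the unrestricted `des_B`. -/
theorem integral_coeffDist_pow {m : ℕ} (hm : m < n) (ε : ℤˣ) :
    ∫ y, y ^ m ∂(coeffDist (eulerianPolyB ε n)) =
      ∫ V : Fin n → UnitAddCircle, (torusDes V : ℝ) ^ m := by
  rw [integral_coeffDist (by omega) ε fun y => y ^ m, sum_sgnB_smul_desB_pow hm]
  simp

theorem integral_torusDes (hn : 1 ≤ n) :
    ∫ V : Fin n → UnitAddCircle, (torusDes V : ℝ) = (n : ℝ) / 2 := by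
  obtain ⟨m, rfl⟩ : ∃ m, n = m + 1 := ⟨n - 1, by omega⟩
  have h := integral_torusDes_sub (m := m)
  rw [integral_sub (integrable_comp_torusDes fun k => (k : ℝ)) (integrable_const _)] at h
  simp only [integral_const, probReal_univ, smul_eq_mul, one_mul] at h
  linarith

theorem distMean_coeffDist (hn : 2 ≤ n) (ε : ℤˣ) :
    distMean (coeffDist (eulerianPolyB ε n)) = (n : ℝ) / 2 := by
  have h := integral_coeffDist_pow (m := 1) (by omega) ε (n := n)
  simp only [pow_one] at h
  rw [distMean, h, integral_torusDes (by omega)]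

theorem distVariance_coeffDist (hn : 3 ≤ n) (ε : ℤˣ) :
    distVariance (coeffDist (eulerianPolyB ε n)) = ((n : ℝ) + 1) / 12 := by
  have hP := isProbabilityMeasure_coeffDist (n := n) (by omega) ε
  have h0 := eval_eulerianPolyB_ne_zero (n := n) (by omega) ε
  have hmean := distMean_coeffDist (n := n) (by omega) ε
  rw [distMean] at hmean
  rw [distVariance, variance_eq_sub]
  · simp only [Pi.pow_apply]
    rw [hmean, integral_coeffDist_pow (by omega)]
    obtain ⟨m, rfl⟩ : ∃ m, n = m + 1 := ⟨n - 1, by omega⟩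
    have h := integral_torusDes_sub_sq (m := m) (by omega)
    have hM := integral_torusDes (n := m + 1) (by omega)
    simp only [sub_sq] at h
    rw [integral_add, integral_sub, integral_mul_const, integral_const_mul, hM] at h
    · simp only [integral_const, probReal_univ, smul_eq_mul, one_mul] at h
      linarith
    · exact integrable_comp_torusDes fun k => (k : ℝ) ^ 2
    · exact integrable_comp_torusDes fun k => 2 * (k : ℝ) * (((m + 1 : ℕ) : ℝ) / 2)
    · exact integrable_comp_torusDes fun k =>
        (k : ℝ) ^ 2 - 2 * (k : ℝ) * (((m + 1 : ℕ) : ℝ) / 2)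
    · exact integrable_const _
  · exact (memLp_two_iff_integrable_sq (by fun_prop)).2 (integrable_coeffDist h0 _)

end coefficients

/-! ### Asymptotic normality -/

section convergence

/-- Lévy's continuity theorem and the portmanteau theorem, for distribution functions. -/
theorem tendsto_real_Iic_of_tendsto_charFun {μ : ℕ → Measure ℝ} [∀ n, IsProbabilityMeasure (μ n)]
    {ν : Measure ℝ} [IsProbabilityMeasure ν] [NullSingletonClass ν]
    (h : ∀ t, Tendsto (fun n => charFun (μ n) t) atTop (𝓝 (charFun ν t))) (x : ℝ) :
    Tendsto (fun n => (μ n).real (Set.Iic x)) atTop (𝓝 (ν.real (Set.Iic x))) := by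
  let μ' : ℕ → ProbabilityMeasure ℝ := fun n => ⟨μ n, inferInstance⟩
  let ν' : ProbabilityMeasure ℝ := ⟨ν, inferInstance⟩
  have hw : Tendsto μ' atTop (𝓝 ν') := ProbabilityMeasure.tendsto_iff_tendsto_charFun.2 h
  have hx := ProbabilityMeasure.tendsto_measure_of_null_frontier_of_tendsto' hw (E := Set.Iic x)
    (by simp [ν'])
  exact (ENNReal.tendsto_toReal (measure_ne_top ν _)).comp hx

theorem norm_inv_card_smul_sum_sgnB_le {E : Type*} [NormedAddCommGroup E] [NormedSpace ℝ E]
    {n : ℕ} (ε : ℤˣ) {f : ℕ → E} (hf : ∀ k, ‖f k‖ ≤ 1) :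
    ‖(Fintype.card (SignedPerm n) : ℝ)⁻¹ • (ε : ℤ) • ∑ w : SignedPerm n, (w.sgnB : ℤ) • f w.desB‖ ≤
      ((n.factorial : ℕ) : ℝ)⁻¹ := by
  have h := norm_sum_sgnB_smul_le n f hf
  have hε : ∀ x : E, ‖(ε : ℤ) • x‖ = ‖x‖ := fun x => by
    rcases Int.units_eq_one_or ε with h | h <;> simp [h]
  rw [norm_smul, hε, norm_inv, Real.norm_natCast, SignedPerm.card_eq]
  refine (mul_le_mul_of_nonneg_left h (by positivity)).trans_eq ?_
  push_cast
  have : (n.factorial : ℝ) ≠ 0 := by positivity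
  field_simp

theorem tendsto_charFun_standardized (ε : ℤˣ) (t : ℝ) :
    Tendsto (fun n : ℕ => charFun ((coeffDist (eulerianPolyB ε (n + 3))).map fun y =>
      (y - ((n + 3 : ℕ) : ℝ) / 2) / √((((n + 3 : ℕ) : ℝ) + 1) / 12)) t) atTop
      (𝓝 (charFun (gaussianReal 0 1) t)) := by
  have hmain := (tendsto_add_atTop_iff_nat 2).2 (tendsto_integral_cexp_torusDes t)
  have hfact : Tendsto (fun n : ℕ => (((n + 3).factorial : ℕ) : ℝ)⁻¹) atTop (𝓝 0) :=
    tendsto_inv_atTop_zero.comp (tendsto_natCast_atTop_atTop.comp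
      (tendsto_atTop_mono (fun n => (Nat.le_add_right n 3).trans (Nat.self_le_factorial _))
        tendsto_id))
  let f : ℕ → ℝ → ℂ := fun n y => Complex.exp
    (((t * ((y - ((n + 3 : ℕ) : ℝ) / 2) / √((((n + 3 : ℕ) : ℝ) + 1) / 12)) : ℝ) : ℂ) * Complex.I)
  have herr : Tendsto (fun n : ℕ => (Fintype.card (SignedPerm (n + 3)) : ℝ)⁻¹ • (ε : ℤ) •
      ∑ w : SignedPerm (n + 3), (w.sgnB : ℤ) • f n w.desB) atTop (𝓝 0) :=
    squeeze_zero_norm (fun n => norm_inv_card_smul_sum_sgnB_le ε (f := fun k : ℕ => f n k)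
      fun k => (Complex.norm_exp_ofReal_mul_I _).le) hfact
  have hsum := hmain.add herr
  rw [add_zero] at hsum
  rw [charFun_gaussianReal]
  convert hsum using 2 with n
  · rw [charFun_apply_real, integral_map (by fun_prop) (by fun_prop),
      ← integral_coeffDist (by omega) ε (f n)]
    simp [f]
  · simp [neg_div]

end convergence

theorem theorem4p5 (ε : ℤˣ) :
    AsymptoticallyNormal (fun n => coeffDist (eulerianPolyB ε n)) ∧
    (∀ n : ℕ, 2 ≤ n → distMean (coeffDist (eulerianPolyB ε n)) = (n : ℝ) / 2) ∧
    (∀ n : ℕ, 3 ≤ n → distVariance (coeffDist (eulerianPolyB ε n)) = ((n : ℝ) + 1) / 12) := by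
  refine ⟨fun x => ?_, fun n hn => distMean_coeffDist hn ε, fun n hn => distVariance_coeffDist hn ε⟩
  -- from `n = 3` on, the mean and the variance have their generic values
  rw [← tendsto_add_atTop_iff_nat 3]
  have hP : ∀ n : ℕ, IsProbabilityMeasure (coeffDist (eulerianPolyB ε (n + 3))) := fun n =>
    isProbabilityMeasure_coeffDist (by omega) ε
  have hmeas : ∀ n : ℕ, Measurable fun y : ℝ =>
      (y - ((n + 3 : ℕ) : ℝ) / 2) / √((((n + 3 : ℕ) : ℝ) + 1) / 12) := fun n => by fun_prop
  have hP' : ∀ n : ℕ, IsProbabilityMeasure ((coeffDist (eulerianPolyB ε (n + 3))).map fun y =>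
      (y - ((n + 3 : ℕ) : ℝ) / 2) / √((((n + 3 : ℕ) : ℝ) + 1) / 12)) := fun n =>
    Measure.isProbabilityMeasure_map (hmeas n).aemeasurable
  have := nullSingletonClass_gaussianReal (μ := 0) (v := 1) one_ne_zero
  refine (tendsto_real_Iic_of_tendsto_charFun (tendsto_charFun_standardized ε) x).congr fun n => ?_
  rw [map_measureReal_apply (hmeas n) measurableSet_Iic, distMean_coeffDist (by omega),
    distVariance_coeffDist (by omega)]
  rfl
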